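/- Let $n$ be a positive integer and let $\mathcal{P}ol=\mathbb{Z}[\tfrac12][x_1,\ldots,x_n]$. Let $s_i$ ($1\le i\le n-1$) be the automorphism of $\mathcal{P}ol$ exchanging $x_i$ and $x_{i+1}$, let $s_0$ send $x_1$ to $-x_1$, and let $s_\heartsuit$ (for $n\ge 2$) send $x_1$ to $-x_2$ and $x_2$ to $-x_1$, the other variables being fixed in each case; write $f^{w}$ for the image of $f$ under $w$. Define operators on $\mathcal{P}ol$, written to the right of their argument and composed from left to right, by $$f\,\partial_i=\frac{f-f^{s_i}}{x_i-x_{i+1}}\ (1\le i\le n-1),\qquad f\,\partial_0=\frac{f-f^{s_0}}{-x_1},\qquad f\,\partial_\heartsuit=\frac{f-f^{s_\heartsuit}}{-x_1-x_2}.$$ Polynomials are regarded as operators acting by multiplication. For $0\le k\le n$ put $$\nabla_k^B(n)=(\partial_0\partial_1\cdots\partial_{n-1})(\partial_0\partial_1\cdots\partial_{n-2})\cdots(\partial_0\partial_1\cdots\partial_{n-k}),$$ and for $0\le k\le n/2$ put $$\nabla_k^D(n)=(\partial_\heartsuit\,\partial_2\cdots\partial_{n-1}\,\partial_1\partial_2\cdots\partial_{n-2})\cdots(\partial_\heartsuit\,\partial_2\cdots\partial_{n-2k+1}\,\partial_1\partial_2\cdots\partial_{n-2k}),$$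 the $j$-th factor ($1\le j\le k$) being $\partial_\heartsuit\,(\partial_2\cdots\partial_{n-2j+1})\,(\partial_1\cdots\partial_{n-2j})$; empty products are the identity. For $m\le n$ let $\mathrm{Sym}(m\,|\,n-m)\subseteq\mathcal{P}ol$ be the subring of polynomials invariant under all $s_i$ with $1\le i\le n-1$, $i\ne m$. Let $k$ be a positive integer with $k\le n/2$. Then, as operators on the ring $\mathrm{Sym}(2k\,|\,n-2k)$ (with values in $\mathcal{P}ol$), $$\nabla_k^D(n)=x_1\cdots x_{2k}\,\nabla_{2k}^B(n)+x_1\cdots x_{2k-1}\,\nabla_{2k-1}^B(n)\,\partial_1\cdots\partial_{n-2k}.$$ -/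

import Mathlib

namespace OrthDivDiff

noncomputable section

/-- The coefficient ring `ℤ[1/2]`. -/
def Coeff : Type := Localization.Away (2 : ℤ)

instance instCommRingCoeff : CommRing Coeff :=
  inferInstanceAs (CommRing (Localization.Away (2 : ℤ)))

instance instIsLocalizationCoeff : IsLocalization.Away (2 : ℤ) Coeff := by
  have e : Ring.toIntAlgebra Coeff =
      (inferInstanceAs (Algebra ℤ (Localization.Away (2 : ℤ))) : Algebra ℤ Coeff) :=
    Subsingleton.elim _ _
  rw [e]
  exact (inferInstance : IsLocalization.Away (2 : ℤ) (Localization.Away (2 : ℤ)))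

instance instIsDomainCoeff : IsDomain Coeff :=
  IsLocalization.isDomain_of_le_nonZeroDivisors (M := Submonoid.powers (2 : ℤ)) Coeff
    (powers_le_nonZeroDivisors_of_noZeroDivisors (two_ne_zero : (2 : ℤ) ≠ 0))

/-- The polynomial ring `ℤ[1/2][x_1, …, x_n]`. -/
abbrev Pol (n : ℕ) : Type := MvPolynomial (Fin n) Coeff

/-- The variable `x_i`, for `1 ≤ i ≤ n` (and `0` when `i` is out of this range). -/
def x (n i : ℕ) : Pol n :=
  if h : 1 ≤ i ∧ i ≤ n then MvPolynomial.X ⟨i - 1, by omega⟩ else 0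

/-- `s_i`, `1 ≤ i < n`, exchanges `x_i` and `x_{i+1}` (the variable with index `j : Fin n`
is `x_{j+1}`). -/
def s (n i : ℕ) : Pol n →ₐ[Coeff] Pol n :=
  MvPolynomial.aeval fun j : Fin n => x n (Equiv.swap i (i + 1) (j.val + 1))

/-- `s_0` sends `x_1` to `-x_1` and fixes the other variables. -/
def sZero (n : ℕ) : Pol n →ₐ[Coeff] Pol n :=
  MvPolynomial.aeval fun j : Fin n => if j.val + 1 = 1 then -x n 1 else x n (j.val + 1)

/-- `s_♡` sends `x_1` to `-x_2`, `x_2` to `-x_1`, and fixes the other variables. -/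
def sHeart (n : ℕ) : Pol n →ₐ[Coeff] Pol n :=
  MvPolynomial.aeval fun j : Fin n =>
    if j.val + 1 = 1 then -x n 2 else if j.val + 1 = 2 then -x n 1 else x n (j.val + 1)

theorem x_succ {n : ℕ} (j : Fin n) : x n (j.val + 1) = MvPolynomial.X j := by
  have h : 1 ≤ j.val + 1 ∧ j.val + 1 ≤ n := ⟨by omega, j.isLt⟩
  rw [x, dif_pos h]
  congr 1

theorem x_ne_zero {n i : ℕ} (h : 1 ≤ i ∧ i ≤ n) : x n i ≠ 0 := by
  rw [x, dif_pos h]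
  exact MvPolynomial.X_ne_zero _

/-- Divisibility of `f - φ f` by `d` need only be checked on the variables. -/
theorem dvd_sub_apply {n : ℕ} (φ : Pol n →ₐ[Coeff] Pol n) (d : Pol n)
    (hd : ∀ j : Fin n, d ∣ MvPolynomial.X j - φ (MvPolynomial.X j)) (f : Pol n) :
    d ∣ f - φ f := by
  induction f using MvPolynomial.induction_on with
  | C a =>
    rw [← MvPolynomial.algebraMap_eq, AlgHom.commutes, sub_self]
    exact dvd_zero d
  | add p q hp hq =>
    have e : p + q - φ (p + q) = (p - φ p) + (q - φ q) := by
      rw [map_add]; ring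
    rw [e]
    exact dvd_add hp hq
  | mul_X p j hp =>
    have e : p * MvPolynomial.X j - φ (p * MvPolynomial.X j)
        = (p - φ p) * MvPolynomial.X j + φ p * (MvPolynomial.X j - φ (MvPolynomial.X j)) := by
      rw [map_mul]; ring
    rw [e]
    exact dvd_add (Dvd.dvd.mul_right hp _) (Dvd.dvd.mul_left (hd j) _)

/-- The operator `f ↦ (f - φ f) / d`, where `d` divides every `f - φ f`
(and the zero operator if `d = 0`). -/
def divDiff {n : ℕ} (φ : Pol n →ₐ[Coeff] Pol n) (d : Pol n)
    (hd : ∀ j : Fin n, d ∣ MvPolynomial.X j - φ (MvPolynomial.X j)) :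
    Pol n →ₗ[Coeff] Pol n :=
  open scoped Classical in
  if h : d = 0 then 0 else
  { toFun := fun f => Classical.choose (dvd_sub_apply φ d hd f)
    map_add' := fun f g => by
      apply mul_left_cancel₀ h
      rw [mul_add, ← Classical.choose_spec (dvd_sub_apply φ d hd (f + g)),
        ← Classical.choose_spec (dvd_sub_apply φ d hd f),
        ← Classical.choose_spec (dvd_sub_apply φ d hd g), map_add]
      ring
    map_smul' := fun c f => by
      apply mul_left_cancel₀ h
      rw [RingHom.id_apply, mul_smul_comm,
        ← Classical.choose_spec (dvd_sub_apply φ d hd (c • f)),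
        ← Classical.choose_spec (dvd_sub_apply φ d hd f), map_smul, smul_sub] }

theorem mul_divDiff {n : ℕ} (φ : Pol n →ₐ[Coeff] Pol n) (d : Pol n)
    (hd : ∀ j : Fin n, d ∣ MvPolynomial.X j - φ (MvPolynomial.X j)) (h : d ≠ 0) (f : Pol n) :
    d * divDiff φ d hd f = f - φ f := by
  rw [divDiff, dif_neg h]
  exact (Classical.choose_spec (dvd_sub_apply φ d hd f)).symm

theorem s_dvd (n i : ℕ) (j : Fin n) :
    x n i - x n (i + 1) ∣ MvPolynomial.X j - s n i (MvPolynomial.X j) := by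
  rw [s, MvPolynomial.aeval_X, ← x_succ j]
  by_cases h1 : j.val + 1 = i
  · rw [h1, Equiv.swap_apply_left]
  · by_cases h2 : j.val + 1 = i + 1
    · rw [h2, Equiv.swap_apply_right]
      exact ⟨-1, by ring⟩
    · rw [Equiv.swap_apply_of_ne_of_ne h1 h2, sub_self]
      exact dvd_zero _

theorem sZero_dvd (n : ℕ) (j : Fin n) :
    -x n 1 ∣ MvPolynomial.X j - sZero n (MvPolynomial.X j) := by
  rw [sZero, MvPolynomial.aeval_X, ← x_succ j]
  split_ifs with h1
  · rw [h1]
    exact ⟨-2, by ring⟩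
  · rw [sub_self]
    exact dvd_zero _

theorem sHeart_dvd (n : ℕ) (j : Fin n) :
    -x n 1 - x n 2 ∣ MvPolynomial.X j - sHeart n (MvPolynomial.X j) := by
  rw [sHeart, MvPolynomial.aeval_X, ← x_succ j]
  split_ifs with h1 h2
  · rw [h1]
    exact ⟨-1, by ring⟩
  · rw [h2]
    exact ⟨-1, by ring⟩
  · rw [sub_self]
    exact dvd_zero _

/-- The simple divided differences `∂_i`: for `1 ≤ i < n` the operator
`f ↦ (f - s_i f) / (x_i - x_{i+1})`, and for `i = 0` the operator `f ↦ (f - s_0 f) / (-x_1)`. -/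
def del (n : ℕ) : ℕ → (Pol n →ₗ[Coeff] Pol n)
  | 0 => divDiff (sZero n) (-x n 1) (sZero_dvd n)
  | i + 1 => divDiff (s n (i + 1)) (x n (i + 1) - x n (i + 2)) (s_dvd n (i + 1))

/-- The divided difference `∂_♡ : f ↦ (f - s_♡ f) / (-x_1 - x_2)`. -/
def delHeart (n : ℕ) : Pol n →ₗ[Coeff] Pol n :=
  divDiff (sHeart n) (-x n 1 - x n 2) (sHeart_dvd n)

theorem x_ne {n i j : ℕ} (hi : 1 ≤ i ∧ i ≤ n) (hj : 1 ≤ j ∧ j ≤ n) (hij : i ≠ j) :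
    x n i ≠ x n j := by
  rw [x, x, dif_pos hi, dif_pos hj]
  intro h
  have := congrArg Fin.val (MvPolynomial.X_injective h)
  simp only at this
  omega

theorem mul_del {n i : ℕ} (h1 : 1 ≤ i) (h2 : i < n) (f : Pol n) :
    (x n i - x n (i + 1)) * del n i f = f - s n i f := by
  obtain ⟨i, rfl⟩ : ∃ k, i = k + 1 := ⟨i - 1, by omega⟩
  exact mul_divDiff _ _ (s_dvd n (i + 1)) (sub_ne_zero.mpr (x_ne (by omega) (by omega) (by omega))) f

theorem mul_del_zero {n : ℕ} (h : 1 ≤ n) (f : Pol n) :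
    (-x n 1) * del n 0 f = f - sZero n f :=
  mul_divDiff _ _ (sZero_dvd n) (neg_ne_zero.mpr (x_ne_zero ⟨le_rfl, h⟩)) f

theorem mul_delHeart {n : ℕ} (h : 2 ≤ n) (f : Pol n) :
    (-x n 1 - x n 2) * delHeart n f = f - sHeart n f := by
  refine mul_divDiff _ _ (sHeart_dvd n) ?_ f
  intro h0
  have e : x n 1 + x n 2 = 0 := by linear_combination -h0
  have e2 := congrArg (MvPolynomial.eval fun j : Fin n => if j.val = 0 then (1 : Coeff) else 0) e
  rw [x, x, dif_pos (by omega), dif_pos (by omega)] at e2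
  simp at e2

/-- The composite of a list of operators acting from the right: `comp [A, B, …, Z]` sends `f` to
`f A B ⋯ Z`, that is, `A` is applied first and `Z` last; the empty composite is the identity. -/
def comp {n : ℕ} (L : List (Pol n →ₗ[Coeff] Pol n)) : Pol n →ₗ[Coeff] Pol n :=
  L.foldl (fun A B => B ∘ₗ A) LinearMap.id

/-- The list `∂_a, ∂_{a+1}, …, ∂_{b-1}` (empty if `b ≤ a`). -/
def dels (n a b : ℕ) : List (Pol n →ₗ[Coeff] Pol n) :=
  (List.Ico a b).map (del n)

/-- `∇_k^B(n) = (∂_0 ∂_1 ⋯ ∂_{n-1}) (∂_0 ∂_1 ⋯ ∂_{n-2}) ⋯ (∂_0 ∂_1 ⋯ ∂_{n-k})`, for `k ≤ n`. -/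
def nablaB (n k : ℕ) : Pol n →ₗ[Coeff] Pol n :=
  comp ((List.range k).flatMap fun j => dels n 0 (n - j))

/-- `∇_k^D(n)`, for `2k ≤ n`: the product, for `j = 0, …, k-1` from left to right, of
`∂_♡ (∂_2 ⋯ ∂_{n-2j-1}) (∂_1 ∂_2 ⋯ ∂_{n-2j-2})`. -/
def nablaD (n k : ℕ) : Pol n →ₗ[Coeff] Pol n :=
  comp ((List.range k).flatMap fun j =>
    delHeart n :: (dels n 2 (n - 2 * j) ++ dels n 1 (n - 2 * j - 1)))

/-- Multiplication by `x_1 ⋯ x_m`, as an operator. -/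
def mulX (n m : ℕ) : Pol n →ₗ[Coeff] Pol n :=
  LinearMap.mulLeft Coeff (∏ i ∈ Finset.Icc 1 m, x n i)

/-- The ring `Sym(m | n-m)` of polynomials invariant under all `s_i`, `1 ≤ i ≤ n-1`, `i ≠ m`. -/
def Sym (n m : ℕ) : Subalgebra Coeff (Pol n) where
  carrier := {f | ∀ i : ℕ, 1 ≤ i → i < n → i ≠ m → s n i f = f}
  mul_mem' := fun {f g} hf hg i h1 h2 h3 => by rw [map_mul, hf i h1 h2 h3, hg i h1 h2 h3]
  add_mem' := fun {f g} hf hg i h1 h2 h3 => by rw [map_add, hf i h1 h2 h3, hg i h1 h2 h3]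
  algebraMap_mem' := fun c i _ _ _ => AlgHom.commutes (s n i) c

end

end OrthDivDiff

/-!
Write `c_N = ∂_0 ∂_1 ⋯ ∂_{N-1}`, operators acting from the right, let `τ = s_0`, and put `m = 2k`. The
argument `f` is invariant under `s_1, …, s_{m-1}`. Three facts give the formula.

* Splitting `∇^D`: since `∂_♡ = τ ∂_1 τ` and `τ` commutes with `∂_2, ∂_3, …`, the `j`-th factor of `∇_k^D(n)`
  is a product of two "twisted runs" `τ ∂_1 ⋯ ∂_{N-1}`, for `N = n - 2j + 2` and then `N - 1`. So
  `∇_k^D(n)` is a product of `m` twisted runs (`nablaD_eq_twistedRuns`).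
* Absorbing `x_1 ⋯ x_{m-1}`: one has `x_1 ∂_0 = -(1 + τ)` and `x_{i+1} ∂_i = ∂_i x_i - 1`, and most terms
  die because `f` is killed by `∂_1, …, ∂_{m-1}`; what is left is
  `x_1 ⋯ x_{m-1} c_N = -τ ∂_1 ⋯ ∂_{N-1} x_1 ⋯ x_{m-2}` (`run_zero_prod_mul`). By induction,
  `x_1 ⋯ x_{m-1} ∇_{m-1}^B(n)` is `(-1)^{m-1}` times the product of the first `m - 1` twisted runs
  (`runs_prod_mul`).
* Moving the last variable: `x_m ∇_m^B(n) = ∇_{m-1}^B(n) x_1 ∂_0 ∂_1 ⋯ ∂_{n-m}` on polynomials invariant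
  under `s_1, …, s_{m-2}` (`runs_x_mul`). The variable is pushed through one run after another by
  `x_{i+1} ∂_i = ∂_i x_i - 1`, and the error terms contain a factor `c_r c_r`, which vanishes
  (`run_run_self`).

As `m - 1` is odd, with `T` the product of the first `m - 1` twisted runs the right-hand side becomes
`-T (x_1 ∂_0) ∂_1 ⋯ ∂_{n-m} - T ∂_1 ⋯ ∂_{n-m} = T τ ∂_1 ⋯ ∂_{n-m}`, the product of all `m` twisted runs.
-/

namespace OrthDivDiff

noncomputable section

variable {n : ℕ}

/-! ### Reflections and divided differences -/

/-- The simple reflections `s_0, s_1, …, s_{n-1}` as one family. -/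
def refl (n : ℕ) : ℕ → (Pol n →ₐ[Coeff] Pol n)
  | 0 => sZero n
  | i + 1 => s n (i + 1)

/-- The denominator of `∂_i`: `-x_1` for `i = 0` and `x_i - x_{i+1}` for `i ≥ 1`. -/
def root (n : ℕ) : ℕ → Pol n
  | 0 => -x n 1
  | i + 1 => x n (i + 1) - x n (i + 2)

theorem algHom_ext_x {φ ψ : Pol n →ₐ[Coeff] Pol n} (h : ∀ j, φ (x n j) = ψ (x n j)) : φ = ψ := by
  refine MvPolynomial.algHom_ext fun j => ?_
  rw [← x_succ j]
  exact h _

theorem x_of_not {j : ℕ} (h : ¬(1 ≤ j ∧ j ≤ n)) : x n j = 0 := by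
  rw [x, dif_neg h]

theorem refl_zero_x (j : ℕ) : refl n 0 (x n j) = if j = 1 then -x n 1 else x n j := by
  by_cases h : 1 ≤ j ∧ j ≤ n
  · obtain ⟨i, rfl⟩ : ∃ i : Fin n, j = i.val + 1 := ⟨⟨j - 1, by omega⟩, by simp; omega⟩
    rw [x_succ, refl, sZero, MvPolynomial.aeval_X, x_succ]
  · rw [x_of_not h, map_zero]
    split_ifs with h1
    · subst h1
      rw [x_of_not h, neg_zero]
    · rfl

theorem refl_x {i : ℕ} (hi : 1 ≤ i) (hin : i < n) (j : ℕ) :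
    refl n i (x n j) = if j = i then x n (i + 1) else if j = i + 1 then x n i else x n j := by
  obtain ⟨i, rfl⟩ : ∃ k, i = k + 1 := ⟨i - 1, by omega⟩
  by_cases h : 1 ≤ j ∧ j ≤ n
  · obtain ⟨l, rfl⟩ : ∃ l : Fin n, j = l.val + 1 := ⟨⟨j - 1, by omega⟩, by simp; omega⟩
    rw [x_succ, refl, s, MvPolynomial.aeval_X, ← x_succ, Equiv.swap_apply_def]
    split_ifs <;> rfl
  · rw [x_of_not h, map_zero, if_neg (by omega), if_neg (by omega)]

theorem sHeart_x (hn : 2 ≤ n) (j : ℕ) : sHeart n (x n j) =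
    if j = 1 then -x n 2 else if j = 2 then -x n 1 else x n j := by
  by_cases h : 1 ≤ j ∧ j ≤ n
  · obtain ⟨l, rfl⟩ : ∃ l : Fin n, j = l.val + 1 := ⟨⟨j - 1, by omega⟩, by simp; omega⟩
    rw [x_succ, sHeart, MvPolynomial.aeval_X, x_succ]
  · rw [x_of_not h, map_zero, if_neg (by omega), if_neg (by omega)]

theorem refl_x_of_ne {i j : ℕ} (hin : i < n) (h1 : j ≠ i) (h2 : j ≠ i + 1) :
    refl n i (x n j) = x n j := by
  rcases Nat.eq_zero_or_pos i with rfl | hi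
  · rw [refl_zero_x, if_neg h2]
  · rw [refl_x hi hin, if_neg h1, if_neg h2]

theorem root_succ {i : ℕ} (hi : 1 ≤ i) : root n i = x n i - x n (i + 1) := by
  obtain ⟨i, rfl⟩ : ∃ k, i = k + 1 := ⟨i - 1, by omega⟩
  rfl

theorem root_ne_zero {i : ℕ} (hin : i < n) : root n i ≠ 0 := by
  rcases Nat.eq_zero_or_pos i with rfl | hi
  · exact neg_ne_zero.mpr (x_ne_zero ⟨le_rfl, hin⟩)
  · rw [root_succ hi]
    exact sub_ne_zero.mpr (x_ne (by omega) (by omega) (by omega))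

theorem root_mul_del {i : ℕ} (hin : i < n) (f : Pol n) :
    root n i * del n i f = f - refl n i f := by
  rcases i with _ | i
  · exact mul_del_zero hin f
  · exact mul_del (by omega) hin f

theorem refl_refl {i : ℕ} (hin : i < n) (f : Pol n) : refl n i (refl n i f) = f := by
  have : (refl n i).comp (refl n i) = AlgHom.id _ _ := by
    refine algHom_ext_x fun j => ?_
    rcases Nat.eq_zero_or_pos i with rfl | hi
    · simp only [AlgHom.comp_apply, refl_zero_x, AlgHom.id_apply]
      split_ifs with h
      · rw [map_neg, refl_zero_x, if_pos rfl, neg_neg, h]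
      · rw [refl_zero_x, if_neg h]
    · simp only [AlgHom.comp_apply, refl_x hi hin, AlgHom.id_apply]
      split_ifs <;> rw [refl_x hi hin] <;> split_ifs <;> first | omega | simp_all
  exact DFunLike.congr_fun this f

theorem refl_comm {i j : ℕ} (hij : i + 2 ≤ j) (hj : j < n) (f : Pol n) :
    refl n i (refl n j f) = refl n j (refl n i f) := by
  have : (refl n i).comp (refl n j) = (refl n j).comp (refl n i) := by
    refine algHom_ext_x fun l => ?_
    simp only [AlgHom.comp_apply]
    by_cases h : l = j ∨ l = j + 1
    · have h1 := refl_x_of_ne (n := n) (i := i) (j := j) (by omega) (by omega) (by omega)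
      have h2 := refl_x_of_ne (n := n) (i := i) (j := j + 1) (by omega) (by omega) (by omega)
      rcases h with rfl | rfl
      · rw [h1, refl_x (by omega) hj, if_pos rfl, h2]
      · rw [h2, refl_x (by omega) hj, if_neg (by omega), if_pos rfl, h1]
    · have h3 := refl_x_of_ne (n := n) (i := j) (j := l) hj (by omega) (by omega)
      rw [h3]
      rcases Nat.eq_zero_or_pos i with rfl | hi
      · rw [refl_zero_x]
        split_ifs with h
        · subst h
          rw [map_neg, h3]
        · rw [h3]
      · rw [refl_x hi (by omega)]
        split_ifs <;> rw [refl_x_of_ne hj (by omega) (by omega)]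
  exact DFunLike.congr_fun this f

theorem refl_braid {i : ℕ} (hi : 1 ≤ i) (hin : i + 1 < n) (f : Pol n) :
    refl n i (refl n (i + 1) (refl n i f)) =
      refl n (i + 1) (refl n i (refl n (i + 1) f)) := by
  have : (refl n i).comp ((refl n (i + 1)).comp (refl n i)) =
      (refl n (i + 1)).comp ((refl n i).comp (refl n (i + 1))) := by
    refine algHom_ext_x fun l => ?_
    simp only [AlgHom.comp_apply]
    have hs := refl_x (n := n) hi (by omega)
    have ht := refl_x (n := n) (i := i + 1) (by omega) hin
    have n1 : i + 1 + 1 ≠ i := by omega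
    have n2 : i ≠ i + 1 + 1 := by omega
    by_cases h1 : l = i
    · subst h1
      simp [hs, ht, n1, n2]
    by_cases h2 : l = i + 1
    · subst h2
      simp [hs, ht, n1, n2]
    by_cases h3 : l = i + 1 + 1
    · subst h3
      simp [hs, ht, n1, n2]
    · simp [hs, ht, h1, h2, h3]
  exact DFunLike.congr_fun this f

theorem refl_braid_zero (hn : 2 ≤ n) (f : Pol n) :
    refl n 0 (refl n 1 (refl n 0 (refl n 1 f))) =
      refl n 1 (refl n 0 (refl n 1 (refl n 0 f))) := by
  have : (refl n 0).comp ((refl n 1).comp ((refl n 0).comp (refl n 1))) =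
      (refl n 1).comp ((refl n 0).comp ((refl n 1).comp (refl n 0))) := by
    refine algHom_ext_x fun l => ?_
    simp only [AlgHom.comp_apply]
    have hs := refl_zero_x (n := n)
    have ht := refl_x (n := n) (i := 1) (by omega) hn
    by_cases h1 : l = 1
    · subst h1
      simp [hs, ht]
    by_cases h2 : l = 2
    · subst h2
      simp [hs, ht]
    · simp [hs, ht, h1, h2]
  exact DFunLike.congr_fun this f

theorem refl_zero_heart (hn : 2 ≤ n) (f : Pol n) :
    refl n 0 (refl n 1 (refl n 0 f)) = sHeart n f := by
  have : (refl n 0).comp ((refl n 1).comp (refl n 0)) = sHeart n := by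
    refine algHom_ext_x fun l => ?_
    simp only [AlgHom.comp_apply]
    have hs := refl_zero_x (n := n)
    have ht := refl_x (n := n) (i := 1) (by omega) hn
    rw [sHeart_x hn]
    by_cases h1 : l = 1
    · subst h1
      simp [hs, ht]
    by_cases h2 : l = 2
    · subst h2
      simp [hs, ht]
    · simp [hs, ht, h1, h2]
  exact DFunLike.congr_fun this f

theorem refl_root_of_lt {i j : ℕ} (hij : i + 2 ≤ j) (hj : j < n) :
    refl n i (root n j) = root n j := by
  rw [root_succ (by omega), map_sub, refl_x_of_ne (by omega) (by omega) (by omega),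
    refl_x_of_ne (by omega) (by omega) (by omega)]

theorem refl_root_of_gt {i j : ℕ} (hij : j + 2 ≤ i) (hi : i < n) :
    refl n i (root n j) = root n j := by
  rcases Nat.eq_zero_or_pos j with rfl | hj
  · rw [root, map_neg, refl_x_of_ne hi (by omega) (by omega)]
  · rw [root_succ hj, map_sub, refl_x_of_ne (by omega) (by omega) (by omega),
      refl_x_of_ne (by omega) (by omega) (by omega)]

/-! ### Relations between the divided differences -/

theorem del_eq_zero {i : ℕ} (hin : i < n) {f : Pol n} (h : refl n i f = f) : del n i f = 0 := by
  apply mul_left_cancel₀ (root_ne_zero hin)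
  rw [root_mul_del hin, h, sub_self, mul_zero]

theorem refl_eq_self {i : ℕ} (hin : i < n) {f : Pol n} (h : del n i f = 0) : refl n i f = f := by
  have := root_mul_del hin f
  rw [h, mul_zero] at this
  exact (sub_eq_zero.mp this.symm).symm

theorem del_mul {i : ℕ} (hin : i < n) {p : Pol n} (hp : refl n i p = p) (f : Pol n) :
    del n i (p * f) = p * del n i f := by
  apply mul_left_cancel₀ (root_ne_zero hin)
  rw [root_mul_del hin, map_mul, hp]
  linear_combination -p * root_mul_del hin f

theorem refl_root_self {i : ℕ} (hin : i < n) : refl n i (root n i) = -root n i := by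
  rcases Nat.eq_zero_or_pos i with rfl | hi
  · rw [root, map_neg, refl_zero_x, if_pos rfl]
  · rw [root_succ hi, map_sub, refl_x hi hin, refl_x hi hin]
    simp

theorem refl_del_self {i : ℕ} (hin : i < n) (f : Pol n) :
    refl n i (del n i f) = del n i f := by
  apply mul_left_cancel₀ (root_ne_zero hin)
  have h := congrArg (refl n i) (root_mul_del hin f)
  rw [map_mul, map_sub, refl_refl hin, refl_root_self hin] at h
  linear_combination -h - root_mul_del hin f

theorem del_del_self {i : ℕ} (hin : i < n) (f : Pol n) : del n i (del n i f) = 0 :=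
  del_eq_zero hin (refl_del_self hin f)

theorem refl_del_comm {i j : ℕ} (hij : i + 2 ≤ j) (hj : j < n) (f : Pol n) :
    refl n i (del n j f) = del n j (refl n i f) := by
  apply mul_left_cancel₀ (root_ne_zero hj)
  rw [root_mul_del hj, ← refl_comm hij hj, ← map_sub, ← root_mul_del hj, map_mul,
    refl_root_of_lt hij hj]

theorem refl_del_comm' {i j : ℕ} (hij : j + 2 ≤ i) (hi : i < n) (f : Pol n) :
    refl n i (del n j f) = del n j (refl n i f) := by
  have hj : j < n := by omega
  apply mul_left_cancel₀ (root_ne_zero hj)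
  rw [root_mul_del hj, refl_comm hij hi, ← map_sub, ← root_mul_del hj, map_mul,
    refl_root_of_gt hij hi]

theorem del_comm {i j : ℕ} (hij : i + 2 ≤ j) (hj : j < n) (f : Pol n) :
    del n i (del n j f) = del n j (del n i f) := by
  have hi : i < n := by omega
  apply mul_left_cancel₀ (root_ne_zero hi)
  rw [root_mul_del hi, refl_del_comm hij hj, ← map_sub, ← root_mul_del hi,
    del_mul hj (refl_root_of_gt hij hj)]

theorem del_braid {i : ℕ} (hi : 1 ≤ i) (hin : i + 1 < n) (f : Pol n) :
    del n i (del n (i + 1) (del n i f)) =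
      del n (i + 1) (del n i (del n (i + 1) f)) := by
  have hi' : i < n := by omega
  have ha := root_ne_zero hi'
  have hb := root_ne_zero hin
  have sb : refl n i (root n (i + 1)) = root n i + root n (i + 1) := by
    rw [root_succ hi, root_succ (by omega), map_sub, refl_x hi hi', refl_x hi hi',
      if_neg (by omega), if_pos rfl, if_neg (by omega), if_neg (by omega)]
    ring
  have ta : refl n (i + 1) (root n i) = root n i + root n (i + 1) := by
    rw [root_succ hi, root_succ (by omega), map_sub, refl_x (by omega) hin,
      refl_x (by omega) hin, if_neg (by omega), if_neg (by omega), if_pos rfl]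
    ring
  have hab : root n i + root n (i + 1) ≠ 0 := by
    rw [← ta, root_succ hi, map_sub, refl_x (by omega) hin, refl_x (by omega) hin, if_neg (by omega),
      if_neg (by omega), if_pos rfl]
    exact sub_ne_zero.mpr (x_ne (by omega) (by omega) (by omega))
  have br := refl_braid hi hin f
  -- Both sides, multiplied by the three positive roots of `A_2`, are the alternating sum over `S_3`.
  have key : ∀ (u v : ℕ) (_ : u < n) (_ : v < n)
      (_ : refl n u (root n v) = root n u + root n v)
      (_ : refl n v (root n u) = root n u + root n v),
      root n u * (root n u * root n v * (root n u + root n v) * del n u (del n v (del n u f))) =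
        root n u * (f - refl n u f - refl n v f + refl n v (refl n u f) + refl n u (refl n v f)
          - refl n u (refl n v (refl n u f))) := by
    intro u v hu hv h1 h2
    have e1 := root_mul_del hu f
    have e2 := root_mul_del hv (del n u f)
    have e3 := root_mul_del hu (del n v (del n u f))
    have e4 := congrArg (refl n v) e1
    have e5 := congrArg (refl n u) e2
    have e6 := congrArg (refl n u) e4
    rw [map_mul, map_sub, h2] at e4
    rw [map_mul, map_sub, h1, refl_del_self hu] at e5
    rw [map_mul, map_mul, map_sub, map_sub, h2, map_add, h1, refl_root_self hu] at e6
    linear_combination root n u * root n v * (root n u + root n v) * e3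
      + root n u * (root n u + root n v) * e2 - root n u * root n v * e5
      + root n u * (e1 - e4 + e6)
  have k1 := mul_left_cancel₀ ha (key i (i + 1) hi' hin sb ta)
  have k2 := mul_left_cancel₀ hb (key (i + 1) i hin hi' (by rw [ta, add_comm]) (by rw [sb, add_comm]))
  apply mul_left_cancel₀ (mul_ne_zero (mul_ne_zero ha hb) hab)
  linear_combination k1 - k2 - br

/-- The instance of the `B_2` braid relation needed here: `∂_0 ∂_1 ∂_0 ∂_1 = ∂_1 ∂_0 ∂_1 ∂_0`, applied
to `f` with `f ∂_1 = 0`. -/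
theorem del_braid_zero (hn : 2 ≤ n) {f : Pol n} (hf : refl n 1 f = f) :
    del n 1 (del n 0 (del n 1 (del n 0 f))) = 0 := by
  have h0 : 0 < n := by omega
  have hx1 : x n 1 ≠ 0 := x_ne_zero (by omega)
  have hx2 : x n 2 ≠ 0 := x_ne_zero (by omega)
  have p1 : refl n 0 (x n 1) = -x n 1 := by rw [refl_zero_x, if_pos rfl]
  have p2 : refl n 0 (x n 2) = x n 2 := by rw [refl_zero_x, if_neg (by omega)]
  have t1 : refl n 1 (x n 1) = x n 2 := by rw [refl_x le_rfl hn, if_pos rfl]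
  have t2 : refl n 1 (x n 2) = x n 1 := by rw [refl_x le_rfl hn, if_neg (by omega), if_pos rfl]
  have hm : x n 1 - x n 2 ≠ 0 := root_ne_zero (i := 1) (by omega)
  have hp : x n 1 + x n 2 ≠ 0 := by
    have : refl n 0 (x n 1 - x n 2) ≠ 0 := by
      intro h
      apply hm
      rw [← refl_refl h0 (x n 1 - x n 2), h, map_zero]
    rw [map_sub, p1, p2] at this
    intro h
    exact this (by linear_combination -h)
  set g := del n 0 f with hg
  set h := del n 1 g with hh
  set k := del n 0 h with hk
  have e1 : -x n 1 * g = f - refl n 0 f := root_mul_del h0 f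
  have e2 : (x n 1 - x n 2) * h = g - refl n 1 g := root_mul_del (i := 1) (by omega) g
  have e3 : -x n 1 * k = h - refl n 0 h := root_mul_del h0 h
  have e4 := congrArg (refl n 0) e2
  have e5 := congrArg (refl n 1) e1
  have e6 := congrArg (refl n 0) e5
  have gp : refl n 0 g = g := refl_del_self h0 f
  simp only [map_mul, map_sub, map_neg, p1, p2, t1, hf, gp] at e4 e5 e6
  have key : x n 1 * x n 2 * (x n 1 - x n 2) * (x n 1 + x n 2) * k =
      (x n 1 + x n 2) * (refl n 1 (refl n 0 f) - refl n 0 f)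
        - (x n 1 - x n 2) * (f - refl n 0 (refl n 1 (refl n 0 f))) := by
    linear_combination -x n 2 * (x n 1 - x n 2) * (x n 1 + x n 2) * e3
      - x n 2 * (x n 1 + x n 2) * e2 - x n 2 * (x n 1 - x n 2) * e4 + 2 * x n 2 * e1
      - (x n 1 + x n 2) * e5 - (x n 1 - x n 2) * e6
  refine del_eq_zero (by omega) ?_
  have key' := congrArg (refl n 1) key
  have br := refl_braid_zero hn f
  rw [hf] at br
  simp only [map_mul, map_sub, map_add, t1, t2, hf, refl_refl (show 1 < n by omega), ← br] at key'
  apply mul_left_cancel₀ (mul_ne_zero (mul_ne_zero (mul_ne_zero hx1 hx2) hm) hp)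
  linear_combination -key' - key

/-- `∂_♡` is the conjugate of `∂_1` by `s_0`. -/
theorem delHeart_eq (hn : 2 ≤ n) (f : Pol n) :
    delHeart n f = refl n 0 (del n 1 (refl n 0 f)) := by
  have h0 : 0 < n := by omega
  have h := congrArg (refl n 0) (root_mul_del (show 1 < n by omega) (refl n 0 f))
  rw [map_mul, map_sub, refl_refl h0, refl_zero_heart hn, root, map_sub, refl_zero_x, if_pos rfl,
    refl_zero_x, if_neg (by omega)] at h
  have h2 := mul_delHeart hn f
  have hne : -x n 1 - x n 2 ≠ 0 := by
    have := (map_ne_zero_iff (refl n 0) (Function.LeftInverse.injective (refl_refl h0))).mpr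
      (root_ne_zero (show 1 < n by omega))
    rwa [root, map_sub, refl_zero_x, if_pos rfl, refl_zero_x, if_neg (by omega)] at this
  apply mul_left_cancel₀ hne
  rw [h2]
  exact h.symm

/-- The operator identity `x_1 ∂_0 = -(1 + s_0)`. -/
theorem del_zero_x_mul (hn : 0 < n) (f : Pol n) :
    del n 0 (x n 1 * f) = -(f + refl n 0 f) := by
  apply mul_left_cancel₀ (root_ne_zero hn)
  rw [root_mul_del hn, map_mul, refl_zero_x, if_pos rfl, root]
  ring

/-- The operator identity `x_{i+1} ∂_i = ∂_i x_i - 1`. -/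
theorem del_x_succ_mul {i : ℕ} (hi : 1 ≤ i) (hin : i < n) (f : Pol n) :
    del n i (x n (i + 1) * f) = x n i * del n i f - f := by
  have h := root_mul_del hin f
  apply mul_left_cancel₀ (root_ne_zero hin)
  rw [root_mul_del hin, map_mul, refl_x hi hin, if_neg (by omega), if_pos rfl]
  rw [root_succ hi] at *
  linear_combination -x n i * h


/-! ### Runs of consecutive divided differences -/

theorem comp_cons (A : Pol n →ₗ[Coeff] Pol n) (L : List (Pol n →ₗ[Coeff] Pol n)) (f : Pol n) :
    comp (A :: L) f = comp L (A f) := by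
  have h : ∀ (L : List (Pol n →ₗ[Coeff] Pol n)) (C : Pol n →ₗ[Coeff] Pol n) (g : Pol n),
      L.foldl (fun A B => B ∘ₗ A) C g = comp L (C g) := by
    intro L
    induction L with
    | nil => intro C g; rfl
    | cons B L ih =>
      intro C g
      rw [List.foldl_cons, ih]
      exact (ih (B ∘ₗ LinearMap.id) (C g)).symm
  exact h L _ f

theorem comp_append (L M : List (Pol n →ₗ[Coeff] Pol n)) (f : Pol n) :
    comp (L ++ M) f = comp M (comp L f) := by
  induction L generalizing f with
  | nil => rfl
  | cons A L ih => rw [List.cons_append, comp_cons, ih, comp_cons]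

/-- The composite `∂_a ∂_{a+1} ⋯ ∂_{b-1}`, as an operator. -/
def run (n a b : ℕ) : Pol n →ₗ[Coeff] Pol n :=
  comp (dels n a b)

theorem run_of_le {a b : ℕ} (h : b ≤ a) (f : Pol n) : run n a b f = f := by
  rw [run, dels, List.Ico.eq_nil_of_le h]
  rfl

theorem run_cons {a b : ℕ} (h : a < b) (f : Pol n) :
    run n a b f = run n (a + 1) b (del n a f) := by
  rw [run, dels, List.Ico.eq_cons h, List.map_cons, comp_cons]
  rfl

theorem run_append {a b c : ℕ} (hab : a ≤ b) (hbc : b ≤ c) (f : Pol n) :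
    run n a c f = run n b c (run n a b f) := by
  rw [run, dels, ← List.Ico.append_consecutive hab hbc, List.map_append, comp_append]
  rfl

theorem run_snoc {a b : ℕ} (h : a ≤ b) (f : Pol n) :
    run n a (b + 1) f = del n b (run n a b f) := by
  rw [run_append h (Nat.le_succ b), run_cons (Nat.lt_succ_self b), run_of_le le_rfl]

theorem run_eq_zero {a b : ℕ} (hab : a < b) (hb : b ≤ n) {f : Pol n} (hf : refl n a f = f) :
    run n a b f = 0 := by
  rw [run_cons hab, del_eq_zero (by omega) hf, map_zero]

theorem run_mul {a b : ℕ} (hb : b ≤ n) {p : Pol n}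
    (hp : ∀ i, a ≤ i → i < b → refl n i p = p) (f : Pol n) :
    run n a b (p * f) = p * run n a b f := by
  induction b with
  | zero => rw [run_of_le (Nat.zero_le a), run_of_le (Nat.zero_le a)]
  | succ b ih =>
    by_cases h : a ≤ b
    · rw [run_snoc h, run_snoc h, ih (by omega) (fun i h1 h2 => hp i h1 (by omega)),
        del_mul (by omega) (hp b h (by omega))]
    · rw [run_of_le (by omega), run_of_le (by omega)]

theorem del_run_comm {a b i : ℕ} (h : i + 2 ≤ a) (hb : b ≤ n) (f : Pol n) :
    del n i (run n a b f) = run n a b (del n i f) := by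
  induction b with
  | zero => rw [run_of_le (Nat.zero_le a), run_of_le (Nat.zero_le a)]
  | succ b ih =>
    by_cases hab : a ≤ b
    · rw [run_snoc hab, run_snoc hab, ← ih (by omega), del_comm (by omega) (by omega)]
    · rw [run_of_le (by omega), run_of_le (by omega)]

theorem refl_run_comm {a b i : ℕ} (h : i + 2 ≤ a) (hb : b ≤ n) (f : Pol n) :
    refl n i (run n a b f) = run n a b (refl n i f) := by
  induction b with
  | zero => rw [run_of_le (Nat.zero_le a), run_of_le (Nat.zero_le a)]
  | succ b ih =>
    by_cases hab : a ≤ b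
    · rw [run_snoc hab, run_snoc hab, ← ih (by omega), refl_del_comm (by omega) (by omega)]
    · rw [run_of_le (by omega), run_of_le (by omega)]

theorem del_run_comm_of_lt {a b i : ℕ} (h : b < i) (hi : i < n) (f : Pol n) :
    del n i (run n a b f) = run n a b (del n i f) := by
  induction b with
  | zero => rw [run_of_le (Nat.zero_le a), run_of_le (Nat.zero_le a)]
  | succ b ih =>
    by_cases hab : a ≤ b
    · rw [run_snoc hab, run_snoc hab, ← ih (by omega), del_comm (by omega) hi]
    · rw [run_of_le (by omega), run_of_le (by omega)]

theorem run_run_comm {a b c d : ℕ} (h : b < c) (hd : d ≤ n) (f : Pol n) :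
    run n a b (run n c d f) = run n c d (run n a b f) := by
  induction d with
  | zero => rw [run_of_le (Nat.zero_le c), run_of_le (Nat.zero_le c)]
  | succ d ih =>
    by_cases hcd : c ≤ d
    · rw [run_snoc hcd, run_snoc hcd, ← ih (by omega), ← del_run_comm_of_lt (by omega) (by omega)]
    · rw [run_of_le (a := c) (by omega), run_of_le (a := c) (by omega)]

/-- The commutation rule `(∂_a ⋯ ∂_{b-1}) ∂_i = ∂_{i+1} (∂_a ⋯ ∂_{b-1})`. -/
theorem del_run_shift {a b i : ℕ} (hi : 1 ≤ i) (ha : a ≤ i) (hib : i + 1 < b) (hb : b ≤ n)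
    (f : Pol n) : del n i (run n a b f) = run n a b (del n (i + 1) f) := by
  have h : ∀ g : Pol n, run n a b g = run n (i + 2) b (del n (i + 1) (del n i (run n a i g))) := by
    intro g
    rw [run_append (b := i + 2) (by omega) (by omega), run_snoc (by omega), run_snoc ha]
  rw [h, h, del_run_comm le_rfl hb, del_braid hi (by omega), del_run_comm_of_lt (by omega) (by omega)]

theorem refl_run_eq_self {a b i : ℕ} (hi : 1 ≤ i) (ha : a ≤ i) (hib : i + 1 < b) (hb : b ≤ n)
    {f : Pol n} (hf : refl n (i + 1) f = f) : refl n i (run n a b f) = run n a b f := by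
  refine refl_eq_self (by omega) ?_
  rw [del_run_shift hi ha hib hb, del_eq_zero (by omega) hf, map_zero]

/-- With `c_r = ∂_0 ⋯ ∂_{r-1}`, the braid relation gives `c_{r+1} c_{r+1} = c_r c_r ∂_r ∂_{r-1}`, so that the
square of `c_r` reduces to that of `c_2`, hence to the braid relation for `B_2`. -/
theorem run_run_self {r : ℕ} (hr : 1 ≤ r) (hrn : r ≤ n) {f : Pol n}
    (hf : 2 ≤ r → refl n 1 f = f) : run n 0 r (run n 0 r f) = 0 := by
  induction r, hr using Nat.le_induction with
  | base =>
    rw [run_snoc le_rfl, run_snoc le_rfl, run_of_le le_rfl, run_of_le le_rfl]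
    exact del_del_self (by omega) f
  | succ r hr ih =>
    obtain ⟨r, rfl⟩ : ∃ q, r = q + 1 := ⟨r - 1, by omega⟩
    rcases Nat.eq_zero_or_pos r with rfl | hr0
    · rw [run_cons (by omega), run_cons (by omega), run_of_le (by omega),
        run_cons (by omega), run_cons (by omega), run_of_le (by omega)]
      exact del_braid_zero (by omega) (hf (by omega))
    · have h := ih (by omega) (fun _ => hf (by omega))
      have hc : ∀ g : Pol n, run n 0 (r + 2) g = del n (r + 1) (del n r (run n 0 r g)) := by
        intro g
        rw [run_snoc (by omega), run_snoc (by omega)]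
      rw [hc, run_snoc (b := r + 1) (by omega), ← del_run_comm_of_lt (by omega) (by omega),
        ← del_braid (by omega) (by omega), ← run_snoc (by omega), h, map_zero, map_zero]

theorem refl_prod_of_lt {i m : ℕ} (hi : 1 ≤ i) (him : i + 1 < m) (hin : i < n) :
    refl n i (∏ j ∈ Finset.Ico 1 m, x n j) = ∏ j ∈ Finset.Ico 1 m, x n j := by
  rw [map_prod]
  refine Finset.prod_equiv (Equiv.swap i (i + 1)) (fun j => ?_) (fun j _ => ?_)
  · simp only [Finset.mem_Ico, Equiv.swap_apply_def]
    split_ifs <;> omega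
  · rw [refl_x hi hin, Equiv.swap_apply_def]
    split_ifs <;> rfl

theorem refl_prod_of_disjoint {i a b : ℕ} (hin : i < n) (h : b ≤ i ∨ i + 1 < a) :
    refl n i (∏ j ∈ Finset.Ico a b, x n j) = ∏ j ∈ Finset.Ico a b, x n j := by
  rw [map_prod]
  refine Finset.prod_congr rfl fun j hj => ?_
  rw [Finset.mem_Ico] at hj
  exact refl_x_of_ne hin (by omega) (by omega)

/-- Each factor `x_{i+1} ∂_i` equals `∂_i x_i - 1`, and the summand `-1` contributes nothing because
`u` is killed by the next divided difference `∂_{i+1}`. -/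
theorem run_prod_mul {a d : ℕ} (ha : 1 ≤ a) (hn : a + d + 1 ≤ n) {u : Pol n}
    (hu : ∀ i, a < i → i ≤ a + d → refl n i u = u) :
    run n a (a + d + 1) ((∏ i ∈ Finset.Ico (a + 1) (a + d + 1), x n i) * u) =
      (∏ i ∈ Finset.Ico a (a + d), x n i) * run n a (a + d + 1) u := by
  induction d generalizing a u with
  | zero => simp
  | succ d ih =>
    have hP := refl_prod_of_disjoint (n := n) (i := a) (a := a + 2) (b := a + (d + 1) + 1)
      (by omega) (by omega)
    have hv : ∀ i, a + 1 < i → i ≤ a + 1 + d →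
        refl n i (x n a * del n a u - u) = x n a * del n a u - u := by
      intro i h1 h2
      rw [map_sub, map_mul, refl_x_of_ne (by omega) (by omega) (by omega),
        refl_del_comm' (by omega) (by omega), hu i (by omega) (by omega)]
    have h := ih (a := a + 1) (by omega) (by omega) hv
    have e : a + 1 + d + 1 = a + (d + 1) + 1 := by omega
    rw [e] at h
    rw [Finset.prod_eq_prod_Ico_succ_bot (by omega), mul_comm (x n (a + 1)), mul_assoc,
      run_cons (by omega), del_mul (by omega) hP, del_x_succ_mul ha (by omega), h, map_sub,
      run_mul hn (p := x n a) (fun i h1 h2 => refl_x_of_ne (by omega) (by omega) (by omega)),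
      run_eq_zero (by omega) hn (hu (a + 1) (by omega) (by omega)), sub_zero,
      Finset.prod_eq_prod_Ico_succ_bot (a := a) (by omega), run_cons (a := a) (by omega),
      show a + 1 + d = a + (d + 1) by omega]
    ring

/-- Multiplication by `x_1 ⋯ x_{p+1}` followed by `∂_0 ⋯ ∂_{N-1}` loses two variables and becomes a
twisted run. Of `x_1 ∂_0 = -(1 + s_0)` only the summand `s_0` survives, because `f ∂_1 = 0`. -/
theorem run_zero_prod_mul {p N : ℕ} (hN : p + 2 ≤ N) (hn : N ≤ n) {f : Pol n}
    (hf : ∀ i, 1 ≤ i → i ≤ p + 1 → refl n i f = f) :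
    run n 0 N ((∏ i ∈ Finset.Ico 1 (p + 2), x n i) * f) =
      -((∏ i ∈ Finset.Ico 1 (p + 1), x n i) * run n 1 N (refl n 0 f)) := by
  have hP := refl_prod_of_disjoint (n := n) (i := 0) (a := 2) (b := p + 2) (by omega) (by omega)
  have hu : ∀ i, 1 < i → i ≤ 1 + p → refl n i (f + refl n 0 f) = f + refl n 0 f := by
    intro i h1 h2
    rw [map_add, ← refl_comm (by omega) (by omega), hf i (by omega) (by omega)]
  have h := run_prod_mul (n := n) (a := 1) (d := p) le_rfl (by omega) hu
  have e : 1 + p + 1 = p + 2 := by omega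
  rw [e, map_add, run_eq_zero (by omega) (by omega) (hf 1 le_rfl (by omega)), zero_add,
    Nat.add_comm 1 p] at h
  rw [Finset.prod_eq_prod_Ico_succ_bot (by omega), mul_assoc, run_cons (by omega),
    del_zero_x_mul (by omega), map_mul, hP, ← mul_add, map_neg, run_append (b := p + 2) (by omega) hN,
    h, run_mul hn, ← run_append (by omega) hN]
  exact fun i h1 h2 => refl_prod_of_disjoint (by omega) (by omega)

/-! ### Products of runs of decreasing length -/

/-- The product `(∂_0 ⋯ ∂_{N-1}) (∂_0 ⋯ ∂_{N-2}) ⋯` of `m` factors. -/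
def runs (n N m : ℕ) : Pol n →ₗ[Coeff] Pol n :=
  comp ((List.range m).flatMap fun j => dels n 0 (N - j))

/-- The product `(s_0 ∂_1 ⋯ ∂_{N-1}) (s_0 ∂_1 ⋯ ∂_{N-2}) ⋯` of `m` factors. -/
def twistedRuns (n N m : ℕ) : Pol n →ₗ[Coeff] Pol n :=
  comp ((List.range m).flatMap fun j => (refl n 0).toLinearMap :: dels n 1 (N - j))

theorem runs_succ (N m : ℕ) (f : Pol n) : runs n N (m + 1) f = runs n (N - 1) m (run n 0 N f) := by
  rw [runs, List.range_succ_eq_map, List.flatMap_cons, comp_append, List.flatMap_map, runs]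
  simp only [Nat.succ_eq_add_one, Nat.sub_zero, Nat.sub_sub, Nat.add_comm 1]
  rfl

theorem twistedRuns_succ (N m : ℕ) (f : Pol n) :
    twistedRuns n N (m + 1) f = twistedRuns n (N - 1) m (run n 1 N (refl n 0 f)) := by
  rw [twistedRuns, List.range_succ_eq_map, List.flatMap_cons, comp_append, List.flatMap_map,
    twistedRuns, comp_cons]
  simp only [Nat.succ_eq_add_one, Nat.sub_zero, Nat.sub_sub, Nat.add_comm 1]
  rfl

theorem twistedRuns_succ' (N m : ℕ) (f : Pol n) :
    twistedRuns n N (m + 1) f = run n 1 (N - m) (refl n 0 (twistedRuns n N m f)) := by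
  rw [twistedRuns, List.range_succ, List.flatMap_append, comp_append, List.flatMap_singleton,
    comp_cons]
  rfl

/-- Two consecutive twisted runs form one factor of `∇^D`. -/
theorem run_refl_run_refl {N : ℕ} (hN : 2 ≤ N) (hn : N ≤ n) (f : Pol n) :
    run n 1 (N - 1) (refl n 0 (run n 1 N (refl n 0 f))) =
      run n 1 (N - 1) (run n 2 N (delHeart n f)) := by
  rw [run_cons (a := 1) (b := N) (by omega), refl_run_comm le_rfl hn, delHeart_eq (by omega)]

/-- On polynomials invariant under `s_1, …, s_p`, the variables `x_1 ⋯ x_p` turn the product of `p` runs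
`∂_0 ⋯ ∂_{N-j}` into the product of `p` twisted runs, up to sign. -/
theorem runs_prod_mul {p N : ℕ} (hN : p + 1 ≤ N) (hn : N ≤ n) {f : Pol n}
    (hf : ∀ i, 1 ≤ i → i ≤ p → refl n i f = f) :
    runs n N p ((∏ i ∈ Finset.Ico 1 (p + 1), x n i) * f) = (-1) ^ p * twistedRuns n N p f := by
  induction p generalizing N f with
  | zero => simp [runs, twistedRuns, comp]
  | succ p ih =>
    have hg : ∀ i, 1 ≤ i → i ≤ p →
        refl n i (run n 1 N (refl n 0 f)) = run n 1 N (refl n 0 f) := fun i h1 h2 =>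
      refl_run_eq_self h1 h1 (by omega) hn
        (by rw [← refl_comm (by omega) (by omega), hf _ (by omega) (by omega)])
    rw [runs_succ, run_zero_prod_mul (by omega) hn hf, map_neg,
      ih (by omega) (by omega) hg, twistedRuns_succ]
    ring

/-- On polynomials invariant under `s_1, …, s_{p-1}`, multiplication by `x_{p+1}` moves through the
first `p` of `p + 1` runs, where it becomes multiplication by `x_1`. -/
theorem runs_x_mul {p N : ℕ} (hN : p + 1 ≤ N) (hn : N ≤ n) {h : Pol n}
    (hh : ∀ i, 1 ≤ i → i < p → refl n i h = h) :
    runs n N (p + 1) (x n (p + 1) * h) = run n 0 (N - p) (x n 1 * runs n N p h) := by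
  induction p generalizing N h with
  | zero =>
    rw [runs_succ]
    rfl
  | succ p ih =>
    have hg : ∀ i, 1 ≤ i → i < p → refl n i (run n 0 N h) = run n 0 N h := fun i h1 h2 =>
      refl_run_eq_self h1 (by omega) (by omega) hn (hh _ (by omega) (by omega))
    have e : run n 0 N (x n (p + 2) * h) =
        x n (p + 1) * run n 0 N h - run n (p + 2) N (run n 0 (p + 1) h) := by
      rw [run_append (b := p + 1) (by omega) (by omega), run_mul (by omega)
        (fun i h1 h2 => refl_x_of_ne (by omega) (by omega) (by omega)), run_cons (by omega),
        del_x_succ_mul (by omega) (by omega), map_sub, run_mul hn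
        (fun i h1 h2 => refl_x_of_ne (by omega) (by omega) (by omega)),
        ← run_cons (a := p + 1) (by omega), ← run_append (by omega) (by omega)]
    -- The error term contains the square of `∂_0 ⋯ ∂_p`.
    have hz : runs n (N - 1) (p + 1) (run n (p + 2) N (run n 0 (p + 1) h)) = 0 := by
      rw [runs_succ, run_append (b := p + 1) (c := N - 1) (by omega) (by omega),
        run_run_comm (by omega) hn,
        run_run_self (by omega) (by omega) (fun h1 => hh 1 le_rfl (by omega)), map_zero, map_zero,
        map_zero]
    rw [runs_succ, e, map_sub, hz, sub_zero, ih (by omega) (by omega) hg, runs_succ, Nat.sub_sub,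
      Nat.add_comm 1 p]

theorem nablaD_eq_twistedRuns {k : ℕ} (hk : 2 * k ≤ n) (f : Pol n) :
    nablaD n k f = twistedRuns n n (2 * k) f := by
  induction k with
  | zero => rfl
  | succ k ih =>
    rw [nablaD, List.range_succ, List.flatMap_append, comp_append, List.flatMap_singleton,
      comp_cons, comp_append]
    change run n 1 (n - 2 * k - 1) (run n 2 (n - 2 * k) (delHeart n (nablaD n k f))) = _
    rw [ih (by omega), show 2 * (k + 1) = 2 * k + 1 + 1 by ring, twistedRuns_succ',
      twistedRuns_succ', ← Nat.sub_sub, run_refl_run_refl (by omega) (by omega)]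

end
end OrthDivDiff

open OrthDivDiff in
theorem corollary8 (n k : ℕ) (hk : 1 ≤ k) (hkn : 2 * k ≤ n)
    (f : OrthDivDiff.Pol n) (hf : f ∈ OrthDivDiff.Sym n (2 * k)) :
    OrthDivDiff.nablaD n k f =
      OrthDivDiff.comp
          [OrthDivDiff.mulX n (2 * k), OrthDivDiff.nablaB n (2 * k)] f +
        OrthDivDiff.comp
          ([OrthDivDiff.mulX n (2 * k - 1), OrthDivDiff.nablaB n (2 * k - 1)] ++
            OrthDivDiff.dels n 1 (n - 2 * k + 1)) f := by
  obtain ⟨p, hp⟩ : ∃ p, 2 * k = p + 1 := ⟨2 * k - 1, by omega⟩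
  have hodd : Odd p := ⟨k - 1, by omega⟩
  have hf' : ∀ i, 1 ≤ i → i ≤ p → refl n i f = f := by
    intro i h1 h2
    obtain ⟨i, rfl⟩ : ∃ q, i = q + 1 := ⟨i - 1, by omega⟩
    exact hf _ (by omega) (by omega) (by omega)
  set P : Pol n := ∏ i ∈ Finset.Ico 1 (p + 1), x n i
  have hPf : ∀ i, 1 ≤ i → i < p → refl n i (P * f) = P * f := by
    intro i h1 h2
    rw [map_mul, hf' i h1 h2.le, refl_prod_of_lt h1 (by omega) (by omega)]
  have hY := runs_prod_mul (n := n) (N := n) (by omega) le_rfl hf'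
  have hQ := runs_x_mul (n := n) (N := n) (by omega) le_rfl hPf
  have e1 : comp [mulX n (p + 1), nablaB n (p + 1)] f = runs n n (p + 1) (x n (p + 1) * (P * f)) := by
    change runs n n (p + 1) ((∏ i ∈ Finset.Ico 1 (p + 1 + 1), x n i) * f) = _
    rw [Finset.prod_Ico_succ_top (by omega), mul_comm P, mul_assoc]
  have e2 : comp ([mulX n p, nablaB n p] ++ dels n 1 (n - p)) f =
      run n 1 (n - p) (runs n n p (P * f)) := by
    rw [comp_append]
    rfl
  rw [nablaD_eq_twistedRuns hkn, hp, Nat.add_sub_cancel, show n - (p + 1) + 1 = n - p by omega,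
    e1, e2, hQ, hY, hodd.neg_one_pow, run_cons (a := 0) (by omega), del_zero_x_mul (by omega),
    twistedRuns_succ', ← map_add]
  congr 1
  rw [map_mul, map_neg, map_one]
  ring
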